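/- Let $\mathsf{COT}$ be the following theory in two-sorted first-order logic with equality on each sort. Lower case variables range over the first sort (ordinals), upper case variables over the second sort (classes). The primitives are a relation $x\mathrel\varepsilon X$ between ordinals and classes, a binary relation $X\prec Y$ on classes, and a partial unary function $\iota$ from classes to ordinals. Write $X\equiv Y$ if $\forall z\,(z\mathrel\varepsilon X\leftrightarrow z\mathrel\varepsilon Y)$, and $X\equiv\{x\mid\phi\}$ if $\forall x\,(x\mathrel\varepsilon X\leftrightarrow\phi)$; an expression $\psi(\{x\mid\phi\})$ means $\forall X\,(X\equiv\{x\mid\phi\}\to\psi(X))$. Define $x<y$ as $\{x\}\prec\{y\}$, and $x\le y$ as $x<y\lor x=y$; $\lim X$ is the least ordinal $l$ with $\forall x\,(x\mathrel\varepsilon X\to x<l)$, if there is one, and $\operatorname{bnd}(X)$ says that $\lim X$ exists. Let $X\sim Y$ say that there is a class of ordered pairs that is a bijection from $X$ to $Y$, where the ordered pair $(a,b)$ is coded by the ordinal $\iota(\{\iota(\{a\}),\iota(\{a,b\})\})$. The axioms of $\mathsf{COT}$ are: 1. Comprehension: $\exists X\,\forall x\,(x\mathrel\varepsilon X\leftrightarrow\phi)$,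 for every formula $\phi$ of the two-sorted language in which $X$ is not free (other free variables of both sorts are allowed). 2. Well-ordering: $X\prec Y\land Y\prec Z\to X\prec Z$; $\;X\not\equiv Y\leftrightarrow(X\prec Y\lor Y\prec X)$; $\;$and $\phi(X)\to\exists M\,(\phi(M)\land\forall Y(\phi(Y)\to\neg\,Y\prec M))$ for every formula $\phi$ of the two-sorted language (with parameters of both sorts). 3. Respective: if $\lim X$ exists, $\lim X\le y$ and $y\mathrel\varepsilon Y$, then $X\prec Y$. 4. Indexing: $\iota(X)$ is defined for every $X$ with $\operatorname{bnd}(X)$; and whenever $\iota(X)$ is defined, $\iota(X)=\lim\{\iota(Y)\mid Y\prec X,\ \iota(Y)\text{ defined}\}$. 5. Infinity: $\exists l\,(\exists k\,(k<l)\land\forall x\,(x<l\to\exists y\,(x<y\land y<l)))$. 6. Boundedness: $\operatorname{bnd}(X)\land X\sim Y\to\operatorname{bnd}(Y)$. For ordinals $x,y$ define $y\in x$ to mean $\exists X\,(y\mathrel\varepsilon X\land\iota(X)=x)$. Then: (i) for every model of $\mathsf{COT}$, its ordinals with the relation $\in$ form a model of $\mathsf{ZFC}$, that is, they satisfy Extensionality,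 Regularity, Pairing, Union, Power, Separation (for every formula of the language of set theory), Infinity, Choice and Replacement (for every formula of the language of set theory); (ii) $\mathsf{COT}$ interprets $\mathsf{ZFC}$: for every axiom $\sigma$ of $\mathsf{ZFC}$, the two-sorted sentence obtained from $\sigma$ by letting all quantifiers range over ordinals, keeping $=$, and replacing $y\in x$ by $\exists X\,(y\mathrel\varepsilon X\land\iota(X)=x)$ is a logical consequence of $\mathsf{COT}$ (true in every model of $\mathsf{COT}$). -/

import Mathlib

universe u v

open FirstOrder

/-! ### The two-sorted language and its structures -/

/-- Formulas of the two-sorted language with primitives `=` (on each sort), `ε`, `≺`, `ι`.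
`COTFormula n m` is the type of formulas whose free variables are among `n` ordinal variables
`x₀, …, xₙ₋₁` and `m` class variables `X₀, …, Xₘ₋₁`. A quantifier in a formula with `n` ordinal
(`m` class) variables binds the new variable `xₙ` (`Xₘ`). The partial function `ι` enters through
its graph: `index X x` is the atomic formula `ι(X) = x`. -/
inductive COTFormula : ℕ → ℕ → Type
  | falsum {n m : ℕ} : COTFormula n m
  | ordEq {n m : ℕ} (x y : Fin n) : COTFormula n m
  | clsEq {n m : ℕ} (X Y : Fin m) : COTFormula n m
  | mem {n m : ℕ} (x : Fin n) (X : Fin m) : COTFormula n m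
  | prec {n m : ℕ} (X Y : Fin m) : COTFormula n m
  | index {n m : ℕ} (X : Fin m) (x : Fin n) : COTFormula n m
  | imp {n m : ℕ} (φ ψ : COTFormula n m) : COTFormula n m
  | allOrd {n m : ℕ} (φ : COTFormula (n + 1) m) : COTFormula n m
  | allCls {n m : ℕ} (φ : COTFormula n (m + 1)) : COTFormula n m

namespace COTFormula

/-- Negation. -/
def neg {n m : ℕ} (φ : COTFormula n m) : COTFormula n m := imp φ falsum

/-- Conjunction. -/
def and {n m : ℕ} (φ ψ : COTFormula n m) : COTFormula n m := neg (imp φ (neg ψ))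

/-- Existential quantification over classes. -/
def exCls {n m : ℕ} (φ : COTFormula n (m + 1)) : COTFormula n m := neg (allCls (neg φ))

end COTFormula

/-- A structure for the two-sorted language: a sort `O` of ordinals, a sort `C` of classes,
the relation `ε` from `O` to `C`, the relation `≺` on `C`, and the partial function `ι` from `C`
to `O` (`index X = some x` says that `ι(X)` is defined and equal to `x`). -/
structure COTStructure (O : Type u) (C : Type v) where
  mem : O → C → Prop
  prec : C → C → Prop
  index : C → Option O

/-- Satisfaction of a formula under an assignment `v` of the ordinal variables and an assignment
`w` of the class variables; equality is interpreted as identity on each sort. -/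
def COTFormula.Realize {O : Type u} {C : Type v} (M : COTStructure O C) :
    {n m : ℕ} → COTFormula n m → (Fin n → O) → (Fin m → C) → Prop
  | _, _, .falsum, _, _ => False
  | _, _, .ordEq x y, v, _ => v x = v y
  | _, _, .clsEq X Y, _, w => w X = w Y
  | _, _, .mem x X, v, w => M.mem (v x) (w X)
  | _, _, .prec X Y, _, w => M.prec (w X) (w Y)
  | _, _, .index X x, v, w => M.index (w X) = some (v x)
  | _, _, .imp φ ψ, v, w => COTFormula.Realize M φ v w → COTFormula.Realize M ψ v w
  | _, _, .allOrd φ, v, w => ∀ a : O, COTFormula.Realize M φ (Fin.snoc v a : Fin _ → O) w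
  | _, _, .allCls φ, v, w => ∀ A : C, COTFormula.Realize M φ v (Fin.snoc w A : Fin _ → C)

namespace COTStructure

variable {O : Type u} {C : Type v} (M : COTStructure O C)

/-! ### The defined notions of COT -/

/-- `X ≡ Y`: the classes `X` and `Y` have the same elements. -/
def CoExt (X Y : C) : Prop := ∀ z, M.mem z X ↔ M.mem z Y

/-- `X ≡ {x}`. -/
def IsSingleton (X : C) (x : O) : Prop := ∀ z, M.mem z X ↔ z = x

/-- `X ≡ {x, y}`. -/
def IsDoubleton (X : C) (x y : O) : Prop := ∀ z, M.mem z X ↔ (z = x ∨ z = y)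

/-- `x < y`, that is, `{x} ≺ {y}`. -/
def Lt (x y : O) : Prop := ∀ X Y, M.IsSingleton X x → M.IsSingleton Y y → M.prec X Y

/-- `x ≤ y`. -/
def Le (x y : O) : Prop := M.Lt x y ∨ x = y

/-- `l = lim X`: `l` is the least ordinal that is greater than all elements of `X`. -/
def IsLim (X : C) (l : O) : Prop :=
  (∀ x, M.mem x X → M.Lt x l) ∧ ∀ k, (∀ x, M.mem x X → M.Lt x k) → M.Le l k

/-- `bnd(X)`. -/
def Bnd (X : C) : Prop := ∃ l, M.IsLim X l

/-- `p` is the ordered pair `(a, b)`, coded by the ordinal `ι({ι({a}), ι({a, b})})`. -/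
def IsPair (p a b : O) : Prop :=
  ∃ (A B P : C) (s t : O), M.IsSingleton A a ∧ M.IsDoubleton B a b ∧
    M.index A = some s ∧ M.index B = some t ∧ M.IsDoubleton P s t ∧ M.index P = some p

/-- The class `F` has the ordered pair `(a, b)` as an element. -/
def PairMem (F : C) (a b : O) : Prop := ∃ p, M.mem p F ∧ M.IsPair p a b

/-- The class `F` is a bijection from `X` to `Y`. -/
def IsBijection (F X Y : C) : Prop :=
  (∀ p, M.mem p F → ∃ x y, M.mem x X ∧ M.mem y Y ∧ M.IsPair p x y) ∧
  (∀ x, M.mem x X → ∃! y, M.mem y Y ∧ M.PairMem F x y) ∧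
  (∀ y, M.mem y Y → ∃! x, M.mem x X ∧ M.PairMem F x y)

/-- `X ∼ Y`: there is a class bijection from `X` to `Y`. -/
def Equinumerous (X Y : C) : Prop := ∃ F, M.IsBijection F X Y

/-! ### The axioms of COT -/

/-- `M` is a model of COT. The two schemata range over all formulas of the two-sorted language,
with arbitrary ordinal and class parameters. -/
structure IsModelOfCOT : Prop where
  comprehension : ∀ {n m : ℕ} (φ : COTFormula (n + 1) m) (v : Fin n → O) (w : Fin m → C),
    ∃ X, ∀ x, M.mem x X ↔ φ.Realize M (Fin.snoc v x : Fin (n + 1) → O) w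
  transitive : ∀ X Y Z, M.prec X Y → M.prec Y Z → M.prec X Z
  coConnected : ∀ X Y, ¬ M.CoExt X Y ↔ (M.prec X Y ∨ M.prec Y X)
  wellFounded : ∀ {n m : ℕ} (φ : COTFormula n (m + 1)) (v : Fin n → O) (w : Fin m → C) (X : C),
    φ.Realize M v (Fin.snoc w X : Fin (m + 1) → C) →
    ∃ N, φ.Realize M v (Fin.snoc w N : Fin (m + 1) → C) ∧
      ∀ Y, φ.Realize M v (Fin.snoc w Y : Fin (m + 1) → C) → ¬ M.prec Y N
  respective : ∀ X Y l y, M.IsLim X l → M.Le l y → M.mem y Y → M.prec X Y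
  /-- Every bounded class has an index. -/
  index_exists : ∀ X, M.Bnd X → ∃ i, M.index X = some i
  /-- `ι(X) = lim {ι(Y) | Y ≺ X}` whenever `ι(X)` is defined. -/
  index_eq : ∀ X i, M.index X = some i →
    ∀ Z, (∀ z, M.mem z Z ↔ ∃ Y, M.prec Y X ∧ M.index Y = some z) → M.IsLim Z i
  infinity : ∃ l, (∃ k, M.Lt k l) ∧ ∀ x, M.Lt x l → ∃ y, M.Lt x y ∧ M.Lt y l
  boundedness : ∀ X Y, M.Bnd X → M.Equinumerous X Y → M.Bnd Y

end COTStructure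

/-- The sentence `φ` is a logical consequence of COT: it is true in every model of COT. -/
def COTEntails (φ : COTFormula 0 0) : Prop :=
  ∀ (O : Type u) (C : Type v) (M : COTStructure O C), M.IsModelOfCOT →
    φ.Realize M Fin.elim0 Fin.elim0

/-! ### The language of set theory and ZFC -/

/-- The only symbol of the language of set theory: a binary relation symbol. -/
inductive SetSymbol : ℕ → Type
  | mem : SetSymbol 2

/-- The first-order language of set theory. -/
def setLang : FirstOrder.Language.{0, 0} := ⟨fun _ => Empty, SetSymbol⟩

namespace ZFC

open FirstOrder.Language

/-- The atomic formula `xᵢ ∈ xⱼ`. -/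
def mem {n : ℕ} (i j : Fin n) : setLang.BoundedFormula Empty n :=
  Relations.boundedFormula₂ (L := setLang) SetSymbol.mem (&i) (&j)

/-- The atomic formula `xᵢ = xⱼ`. -/
def eq {n : ℕ} (i j : Fin n) : setLang.BoundedFormula Empty n :=
  Term.bdEqual (L := setLang) (&i) (&j)

/-- For a formula `φ(p₀, …, pₙ₋₁, y₀, …, yₖ₋₁)`, the formula `φ(x₀, …, xₙ₋₁, x_{t 0}, …)`. -/
def inst {n k : ℕ} (r : ℕ) (φ : setLang.Formula (Fin n ⊕ Fin k)) (t : Fin k → Fin (n + r)) :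
    setLang.BoundedFormula Empty (n + r) :=
  BoundedFormula.relabel (n := n + r) (k := 0)
    (Sum.elim (fun i => Sum.inr (Fin.castAdd r i)) (fun j => Sum.inr (t j))) φ

/-- `∀ x ∀ y (∀ z (z ∈ x ↔ z ∈ y) → x = y)` -/
def extensionality : setLang.Sentence :=
  ∀' ∀' ((∀' (mem 2 0 ⇔ mem 2 1)) ⟹ eq 0 1)

/-- `∀ a (∃ x (x ∈ a) → ∃ y (y ∈ a ∧ ¬ ∃ c (c ∈ y ∧ c ∈ a)))` -/
def regularity : setLang.Sentence :=
  ∀' ((∃' mem 1 0) ⟹ ∃' (mem 1 0 ⊓ ∼ (∃' (mem 2 1 ⊓ mem 2 0))))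

/-- `∀ a ∀ b ∃ x ∀ y (y ∈ x ↔ y = a ∨ y = b)` -/
def pairing : setLang.Sentence :=
  ∀' ∀' ∃' ∀' (mem 3 2 ⇔ (eq 3 0 ⊔ eq 3 1))

/-- `∀ a ∃ x ∀ y (y ∈ x ↔ ∃ z (z ∈ a ∧ y ∈ z))` -/
def union : setLang.Sentence :=
  ∀' ∃' ∀' (mem 2 1 ⇔ ∃' (mem 3 0 ⊓ mem 2 3))

/-- `∀ a ∃ x ∀ y (y ∈ x ↔ ∀ z (z ∈ y → z ∈ a))` -/
def power : setLang.Sentence :=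
  ∀' ∃' ∀' (mem 2 1 ⇔ ∀' (mem 3 2 ⟹ mem 3 0))

/-- `∀ p₀ … pₙ₋₁ ∀ a ∃ x ∀ y (y ∈ x ↔ y ∈ a ∧ φ(p, a, y))` -/
def separation {n : ℕ} (φ : setLang.Formula (Fin n ⊕ Fin 2)) : setLang.Sentence :=
  let a : Fin (n + 3) := Fin.natAdd n 0
  let x : Fin (n + 3) := Fin.natAdd n 1
  let y : Fin (n + 3) := Fin.natAdd n 2
  BoundedFormula.alls (n := n + 1) (∃' ∀' (mem y x ⇔ (mem y a ⊓ inst 3 φ ![a, y])))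

/-- `∃ a (∃ e (e ∈ a ∧ ∀ z (z ∉ e)) ∧ ∀ x (x ∈ a → ∃ s (s ∈ a ∧ ∀ z (z ∈ s ↔ z ∈ x ∨ z = x))))` -/
def infinity : setLang.Sentence :=
  ∃' ((∃' (mem 1 0 ⊓ ∀' ∼ (mem 2 1))) ⊓
    ∀' (mem 1 0 ⟹ ∃' (mem 2 0 ⊓ ∀' (mem 3 2 ⇔ (mem 3 1 ⊔ eq 3 1)))))

/-- Every set `a` of nonempty pairwise disjoint sets has a transversal:
`∀ a (∀ x (x ∈ a → ∃ y (y ∈ x)) ∧ ∀ x ∀ y (x ∈ a ∧ y ∈ a ∧ ∃ z (z ∈ x ∧ z ∈ y) → x = y) →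
∃ c ∀ x (x ∈ a → ∃ y ∀ z (z ∈ x ∧ z ∈ c ↔ z = y)))` -/
def choice : setLang.Sentence :=
  ∀' (((∀' (mem 1 0 ⟹ ∃' mem 2 1)) ⊓
      ∀' ∀' ((mem 1 0 ⊓ mem 2 0 ⊓ ∃' (mem 3 1 ⊓ mem 3 2)) ⟹ eq 1 2)) ⟹
    ∃' ∀' (mem 2 0 ⟹ ∃' ∀' ((mem 4 2 ⊓ mem 4 1) ⇔ eq 4 3)))

/-- `∀ p₀ … pₙ₋₁ ∀ a (∀ x ∀ y ∀ z (x ∈ a ∧ φ(p, a, x, y) ∧ φ(p, a, x, z) → y = z) →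
∃ b ∀ y (y ∈ b ↔ ∃ x (x ∈ a ∧ φ(p, a, x, y))))` -/
def replacement {n : ℕ} (φ : setLang.Formula (Fin n ⊕ Fin 3)) : setLang.Sentence :=
  let functional : setLang.BoundedFormula Empty (n + 1) :=
    let a : Fin (n + 4) := Fin.natAdd n 0
    let x : Fin (n + 4) := Fin.natAdd n 1
    let y : Fin (n + 4) := Fin.natAdd n 2
    let z : Fin (n + 4) := Fin.natAdd n 3
    ∀' ∀' ∀' ((mem x a ⊓ inst 4 φ ![a, x, y] ⊓ inst 4 φ ![a, x, z]) ⟹ eq y z)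
  let image : setLang.BoundedFormula Empty (n + 1) :=
    let a : Fin (n + 4) := Fin.natAdd n 0
    let b : Fin (n + 3) := Fin.natAdd n 1
    let y : Fin (n + 3) := Fin.natAdd n 2
    let y' : Fin (n + 4) := Fin.natAdd n 2
    let x : Fin (n + 4) := Fin.natAdd n 3
    ∃' ∀' (mem y b ⇔ ∃' (mem x a ⊓ inst 4 φ ![a, x, y']))
  BoundedFormula.alls (n := n + 1) (functional ⟹ image)

/-- The axioms of ZFC. -/
inductive Axiom : setLang.Sentence → Prop
  | extensionality : Axiom extensionality
  | regularity : Axiom regularity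
  | pairing : Axiom pairing
  | union : Axiom union
  | power : Axiom power
  | separation {n : ℕ} (φ : setLang.Formula (Fin n ⊕ Fin 2)) : Axiom (separation φ)
  | infinity : Axiom infinity
  | choice : Axiom choice
  | replacement {n : ℕ} (φ : setLang.Formula (Fin n ⊕ Fin 3)) : Axiom (replacement φ)

/-- The theory ZFC. -/
def theory : setLang.Theory := {σ | Axiom σ}

end ZFC

/-! ### The interpretation -/

/-- The membership relation on ordinals: `y ∈ x` if `y ε X` for some class `X` with `ι(X) = x`. -/
def COTStructure.SetMem {O : Type u} {C : Type v} (M : COTStructure O C) (y x : O) : Prop :=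
  ∃ X, M.mem y X ∧ M.index X = some x

/-- The ordinals with the relation `SetMem` as a structure for the language of set theory. -/
@[reducible] def COTStructure.setStructure {O : Type u} {C : Type v} (M : COTStructure O C) :
    setLang.Structure O where
  funMap f _ := Empty.elim f
  RelMap
    | SetSymbol.mem, v => M.SetMem (v 0) (v 1)

/-- The variable that a term of the language of set theory consists of. -/
def setTermVar {n : ℕ} : setLang.Term (Empty ⊕ Fin n) → Fin n
  | .var (.inl e) => e.elim
  | .var (.inr i) => i
  | .func f _ => Empty.elim f

/-- The two-sorted formula `∃ X (y ε X ∧ ι(X) = x)`. -/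
def COTFormula.setMem {n : ℕ} (y x : Fin n) : COTFormula n 0 :=
  exCls (and (mem y 0) (index 0 x))

/-- The translation of formulas of set theory into the two-sorted language: quantifiers range over
the ordinals, `=` is translated as equality of ordinals and `y ∈ x` as `∃ X (y ε X ∧ ι(X) = x)`. -/
def translateSet : {n : ℕ} → setLang.BoundedFormula Empty n → COTFormula n 0
  | _, .falsum => .falsum
  | _, .equal s t => .ordEq (setTermVar s) (setTermVar t)
  | _, .rel SetSymbol.mem ts => .setMem (setTermVar (ts 0)) (setTermVar (ts 1))
  | _, .imp φ ψ => .imp (translateSet φ) (translateSet ψ)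
  | _, .all φ => .allOrd (translateSet φ)

/-! The index `ι` is an isomorphism from the bounded classes, ordered by `≺` and taken up to `≡`,
onto the ordinals. It is strictly increasing because `ι(X)` is the limit of the earlier indices
(`index_lt_index`), hence injective up to coextension. Its values have no gaps, and they are
unbounded because elements of a class lie below its index (`lt_index_of_mem`); so every ordinal is
an index (`exists_index_eq`). This uses that there is no greatest ordinal (`exists_ord_gt`).

Thus each ordinal codes one bounded class, `∈` implies `<`, and every bounded definable class is a
set (`exists_set`). Extensionality is injectivity of `ι`; Regularity and Choice take least elements;
Pairing, Union and Separation need only a bound. For Power, the Respective axiom puts all subsets of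
`a` below the index of `{a}`. For Replacement, a definable function is cut down to a class
bijection, to which Boundedness applies (`exists_bound_image`).

Infinity is the delicate axiom. The set of all ordinals below the least nonzero limit `ω` witnesses
it, provided `x ∪ {x}` stays below `ω`. This follows once, for each `n < ω`, the sets of ordinals
below `n` are bounded below `ω` (`exists_bound_powerset`).

The schemata speak of formulas, so the predicates fed to them carry a definability instance, found
by instance search. -/

/-! ### Definability with parameters

Environments are streams of ordinals and of classes; a quantifier pushes its variable in front. -/

section Definability

variable {O : Type u} {C : Type v}

/-- A map from environments to individuals that is a projection or a constant. -/
class IsTerm {α : Type*} (t : (ℕ → α) → α) : Prop where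
  out : ∃ τ : ℕ ⊕ α, ∀ v, t v = Sum.elim v id τ

instance IsTerm.var {α : Type*} (i : ℕ) : IsTerm (fun v : ℕ → α => v i) := ⟨.inl i, fun _ => rfl⟩

theorem IsTerm.eq_or {α : Type*} (t : (ℕ → α) → α) [ht : IsTerm t] :
    (∃ i, t = fun v => v i) ∨ ∃ a, t = fun _ => a := by
  obtain ⟨i | a, h⟩ := ht
  exacts [.inl ⟨i, funext h⟩, .inr ⟨a, funext h⟩]

instance IsTerm.const {α : Type*} (a : α) : IsTerm (fun _ : ℕ → α => a) := ⟨.inr a, fun _ => rfl⟩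

theorem IsTerm.shift {α : Type*} (t : (ℕ → α) → α) [ht : IsTerm t] :
    IsTerm (fun v => t fun k => v (k + 1)) := by
  rcases IsTerm.eq_or t with ⟨i, rfl⟩ | ⟨a, rfl⟩ <;> infer_instance

/-- The predicate `P` on environments is given by a formula with parameters: there are finite lists
`A`, `B` of variables and parameters such that, whenever these are represented among the variables
of a formula, some formula defines `P`. -/
class Definable₂ (M : COTStructure O C) (P : (ℕ → O) → (ℕ → C) → Prop) : Prop where
  out : ∃ (A : List (ℕ ⊕ O)) (B : List (ℕ ⊕ C)), ∀ (n m : ℕ) (i : ℕ ⊕ O → Fin n)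
    (j : ℕ ⊕ C → Fin m), ∃ φ : COTFormula n m, ∀ (x : Fin n → O) (X : Fin m → C) (v : ℕ → O)
    (w : ℕ → C), (∀ τ ∈ A, x (i τ) = Sum.elim v id τ) → (∀ τ ∈ B, X (j τ) = Sum.elim w id τ) →
    (φ.Realize M x X ↔ P v w)

/-! ### Closure properties of definable predicates. -/

namespace Definable₂

variable {M : COTStructure O C}

theorem congr {P Q : (ℕ → O) → (ℕ → C) → Prop} (hP : Definable₂ M P)
    (h : ∀ v w, P v w ↔ Q v w) : Definable₂ M Q := by
  have : P = Q := by ext v w; exact h v w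
  exact this ▸ hP

instance mem (t : (ℕ → O) → O) (T : (ℕ → C) → C) [ht : IsTerm t] [hT : IsTerm T] :
    Definable₂ M (fun v w => M.mem (t v) (T w)) := by
  obtain ⟨τ, hτ⟩ := ht
  obtain ⟨σ, hσ⟩ := hT
  refine ⟨[τ], [σ], fun n m i j => ⟨.mem (i τ) (j σ), fun x X v w hA hB => ?_⟩⟩
  simp [COTFormula.Realize, hA τ (by simp), hB σ (by simp), hτ, hσ]

instance index (t : (ℕ → O) → O) (T : (ℕ → C) → C) [ht : IsTerm t] [hT : IsTerm T] :
    Definable₂ M (fun v w => M.index (T w) = some (t v)) := by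
  obtain ⟨τ, hτ⟩ := ht
  obtain ⟨σ, hσ⟩ := hT
  refine ⟨[τ], [σ], fun n m i j => ⟨.index (j σ) (i τ), fun x X v w hA hB => ?_⟩⟩
  simp [COTFormula.Realize, hA τ (by simp), hB σ (by simp), hτ, hσ]

instance prec (S T : (ℕ → C) → C) [hS : IsTerm S] [hT : IsTerm T] :
    Definable₂ M (fun _ w => M.prec (S w) (T w)) := by
  obtain ⟨τ, hτ⟩ := hS
  obtain ⟨σ, hσ⟩ := hT
  refine ⟨[], [τ, σ], fun n m i j => ⟨.prec (j τ) (j σ), fun x X v w hA hB => ?_⟩⟩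
  simp [COTFormula.Realize, hB τ (by simp), hB σ (by simp), hτ, hσ]

instance eq (s t : (ℕ → O) → O) [hs : IsTerm s] [ht : IsTerm t] :
    Definable₂ M (fun v _ => s v = t v) := by
  obtain ⟨τ, hτ⟩ := hs
  obtain ⟨σ, hσ⟩ := ht
  refine ⟨[τ, σ], [], fun n m i j => ⟨.ordEq (i τ) (i σ), fun x X v w hA hB => ?_⟩⟩
  simp [COTFormula.Realize, hA τ (by simp), hA σ (by simp), hτ, hσ]

instance false : Definable₂ M (fun _ _ => False) :=
  ⟨[], [], fun _ _ _ _ => ⟨.falsum, fun _ _ _ _ _ _ => Iff.rfl⟩⟩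

instance imp (P Q : (ℕ → O) → (ℕ → C) → Prop) [hP : Definable₂ M P] [hQ : Definable₂ M Q] :
    Definable₂ M (fun v w => P v w → Q v w) := by
  obtain ⟨A, B, h⟩ := hP
  obtain ⟨A', B', h'⟩ := hQ
  refine ⟨A ++ A', B ++ B', fun n m i j => ?_⟩
  obtain ⟨φ, hφ⟩ := h n m i j
  obtain ⟨ψ, hψ⟩ := h' n m i j
  refine ⟨.imp φ ψ, fun x X v w hA hB => ?_⟩
  simp only [List.mem_append] at hA hB
  exact imp_congr (hφ x X v w (fun τ h => hA τ (.inl h)) fun τ h => hB τ (.inl h))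
    (hψ x X v w (fun τ h => hA τ (.inr h)) fun τ h => hB τ (.inr h))

/-- The variable or parameter that `τ` becomes when the first variable is removed. -/
def pred {α : Type*} : ℕ ⊕ α → ℕ ⊕ α := Sum.map Nat.pred id

/-- Extend a numbering of variables and parameters by a new first variable. -/
def push {α : Type*} {n : ℕ} (i : ℕ ⊕ α → Fin n) : ℕ ⊕ α → Fin (n + 1)
  | .inl 0 => Fin.last n
  | .inl (k + 1) => (i (.inl k)).castSucc
  | .inr a => (i (.inr a)).castSucc

/-- Formulas bind their last variable, while streams receive the new value in front; this reconciles
the two conventions at a quantifier. -/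
theorem snoc_push {α : Type*} {n : ℕ} {i : ℕ ⊕ α → Fin n} {A : List (ℕ ⊕ α)} {x : Fin n → α}
    {v : ℕ → α} (h : ∀ τ ∈ A.map pred, x (i τ) = Sum.elim v id τ) (a : α) :
    ∀ τ ∈ A, (Fin.snoc x a : Fin (n + 1) → α) (push i τ) =
      Sum.elim (fun k => Nat.casesOn k a v : ℕ → α) id τ := by
  rintro ((_ | k) | b) hτ
  · simp [push]
  · simpa [push] using h (.inl k) (List.mem_map.2 ⟨_, hτ, rfl⟩)
  · simpa [push] using h (.inr b) (List.mem_map.2 ⟨_, hτ, rfl⟩)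

instance allOrd (P : (ℕ → O) → (ℕ → C) → O → Prop)
    [hP : Definable₂ M (fun v w => P (fun k => v (k + 1)) w (v 0))] :
    Definable₂ M (fun v w => ∀ a : O, P v w a) := by
  obtain ⟨A, B, h⟩ := hP
  refine ⟨A.map pred, B, fun n m i j => ?_⟩
  obtain ⟨φ, hφ⟩ := h (n + 1) m (push i) j
  refine ⟨.allOrd φ, fun x X v w hA hB => forall_congr' fun a => ?_⟩
  exact hφ _ X _ w (snoc_push hA a) hB

instance allCls (P : (ℕ → O) → (ℕ → C) → C → Prop)
    [hP : Definable₂ M (fun v w => P v (fun k => w (k + 1)) (w 0))] :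
    Definable₂ M (fun v w => ∀ a : C, P v w a) := by
  obtain ⟨A, B, h⟩ := hP
  refine ⟨A, B.map pred, fun n m i j => ?_⟩
  obtain ⟨φ, hφ⟩ := h n (m + 1) i (push j)
  refine ⟨.allCls φ, fun x X v w hA hB => forall_congr' fun a => ?_⟩
  exact hφ x _ v _ hA (snoc_push hB a)

instance not (P : (ℕ → O) → (ℕ → C) → Prop) [Definable₂ M P] :
    Definable₂ M (fun v w => ¬ P v w) :=
  imp P _

instance and (P Q : (ℕ → O) → (ℕ → C) → Prop) [Definable₂ M P] [Definable₂ M Q] :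
    Definable₂ M (fun v w => P v w ∧ Q v w) :=
  congr (P := fun v w => ¬ (P v w → ¬ Q v w)) inferInstance fun v w => by tauto

instance or (P Q : (ℕ → O) → (ℕ → C) → Prop) [Definable₂ M P] [Definable₂ M Q] :
    Definable₂ M (fun v w => P v w ∨ Q v w) :=
  congr (P := fun v w => ¬ P v w → Q v w) inferInstance fun v w => by tauto

instance iff (P Q : (ℕ → O) → (ℕ → C) → Prop) [Definable₂ M P] [Definable₂ M Q] :
    Definable₂ M (fun v w => P v w ↔ Q v w) :=
  congr (P := fun v w => (P v w → Q v w) ∧ (Q v w → P v w)) inferInstance fun v w => by tauto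

instance exOrd (P : (ℕ → O) → (ℕ → C) → O → Prop)
    [Definable₂ M (fun v w => P (fun k => v (k + 1)) w (v 0))] :
    Definable₂ M (fun v w => ∃ a : O, P v w a) :=
  congr (P := fun v w => ¬ ∀ a : O, ¬ P v w a) inferInstance fun v w => by simp

instance exCls (P : (ℕ → O) → (ℕ → C) → C → Prop)
    [Definable₂ M (fun v w => P v (fun k => w (k + 1)) (w 0))] :
    Definable₂ M (fun v w => ∃ a : C, P v w a) :=
  congr (P := fun v w => ¬ ∀ a : C, ¬ P v w a) inferInstance fun v w => by simp

instance setMem (s t : (ℕ → O) → O) [IsTerm s] [IsTerm t] :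
    Definable₂ M (fun v _ => M.SetMem (s v) (t v)) := by
  unfold COTStructure.SetMem; infer_instance

instance isSingleton (T : (ℕ → C) → C) (t : (ℕ → O) → O) [IsTerm T] [IsTerm t] :
    Definable₂ M (fun v w => M.IsSingleton (T w) (t v)) := by
  unfold COTStructure.IsSingleton
  -- Under the quantifier `t` occurs shifted, which instance search recognizes only for an explicit
  -- projection or constant.
  rcases IsTerm.eq_or t with ⟨i, rfl⟩ | ⟨a, rfl⟩ <;> infer_instance

instance isDoubleton (T : (ℕ → C) → C) (s t : (ℕ → O) → O) [IsTerm T] [IsTerm s] [IsTerm t] :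
    Definable₂ M (fun v w => M.IsDoubleton (T w) (s v) (t v)) := by
  unfold COTStructure.IsDoubleton
  rcases IsTerm.eq_or s with ⟨i, rfl⟩ | ⟨a, rfl⟩ <;>
  rcases IsTerm.eq_or t with ⟨j, rfl⟩ | ⟨b, rfl⟩ <;> infer_instance

instance lt (s t : (ℕ → O) → O) [IsTerm s] [IsTerm t] :
    Definable₂ M (fun v _ => M.Lt (s v) (t v)) := by
  unfold COTStructure.Lt; infer_instance

instance isPair (r s t : (ℕ → O) → O) [IsTerm r] [IsTerm s] [IsTerm t] :
    Definable₂ M (fun v _ => M.IsPair (r v) (s v) (t v)) := by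
  unfold COTStructure.IsPair
  rcases IsTerm.eq_or r with ⟨i, rfl⟩ | ⟨a, rfl⟩ <;>
  rcases IsTerm.eq_or s with ⟨j, rfl⟩ | ⟨b, rfl⟩ <;>
  rcases IsTerm.eq_or t with ⟨k, rfl⟩ | ⟨c, rfl⟩ <;> infer_instance

/-- Formulas of set theory define definable predicates. -/
theorem realize {α : Type*} {n : ℕ} (φ : setLang.BoundedFormula α n) :
    ∀ (s : α → (ℕ → O) → O) (t : Fin n → (ℕ → O) → O), (∀ i, IsTerm (s i)) → (∀ i, IsTerm (t i)) →
      Definable₂ M (fun v _ =>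
        @Language.BoundedFormula.Realize setLang O M.setStructure α n φ (fun i => s i v)
          fun i => t i v) := by
  let _ := M.setStructure
  have key : ∀ {n : ℕ} (s : α → (ℕ → O) → O) (t : Fin n → (ℕ → O) → O), (∀ i, IsTerm (s i)) →
      (∀ i, IsTerm (t i)) → ∀ r : setLang.Term (α ⊕ Fin n),
      IsTerm (fun v => r.realize (Sum.elim (fun i => s i v) fun i => t i v)) := by
    rintro n s t hs ht ((i | i) | f)
    · exact hs i
    · exact ht i
    · exact Empty.elim f
  induction φ with
  | falsum => exact fun _ _ _ _ => inferInstanceAs (Definable₂ M fun _ _ => False)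
  | equal r r' =>
    intro s t hs ht
    have := key s t hs ht r
    have := key s t hs ht r'
    exact Definable₂.eq (fun v => r.realize (Sum.elim (fun i => s i v) fun i => t i v))
      (fun v => r'.realize (Sum.elim (fun i => s i v) fun i => t i v))
  | rel R rs =>
    intro s t hs ht
    cases R
    have := key s t hs ht (rs 0)
    have := key s t hs ht (rs 1)
    exact Definable₂.setMem (fun v => (rs 0).realize (Sum.elim (fun i => s i v) fun i => t i v))
      (fun v => (rs 1).realize (Sum.elim (fun i => s i v) fun i => t i v))
  | imp φ ψ hφ hψ =>
    intro s t hs ht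
    have := hφ s t hs ht
    have := hψ s t hs ht
    exact Definable₂.imp (fun v _ => φ.Realize (fun i => s i v) fun i => t i v)
      fun v _ => ψ.Realize (fun i => s i v) fun i => t i v
  | @all n φ hφ =>
    intro s t hs ht
    -- The bound variable is last in the formula but sits at position 0 of the stream; the older
    -- terms are shifted past it.
    let t' : Fin (n + 1) → (ℕ → O) → O :=
      Fin.snoc (fun i v => t i fun k => v (k + 1)) fun v => v 0
    have ht' : ∀ i, IsTerm (t' i) := by
      refine Fin.lastCases ?_ fun i => ?_
      · simpa [t'] using IsTerm.var 0
      · simpa [t'] using IsTerm.shift (t i)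
    have := hφ (fun i v => s i fun k => v (k + 1)) t' (fun i => IsTerm.shift (s i)) ht'
    refine @Definable₂.allOrd _ _ M (fun v _ a => φ.Realize (fun i => s i v)
      (Fin.snoc (fun i => t i v) a)) (this.congr fun v w => ?_)
    have : (fun i => t' i v) =
        (Fin.snoc (fun i => t i fun k => v (k + 1)) (v 0) : Fin (n + 1) → O) := by
      funext i
      induction i using Fin.lastCases <;> simp [t']
    rw [this]

/-- Finitely many variables and parameters can be numbered. -/
theorem exists_numbering {α : Type*} (A : List (ℕ ⊕ α)) (v : ℕ → α) :
    ∃ (n : ℕ) (i : ℕ ⊕ α → Fin n) (x : Fin n → α), ∀ τ ∈ A, x (i τ) = Sum.elim v id τ := by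
  -- The extra index keeps the type nonempty when `A` is empty, so that the numbering can be total;
  -- the default value there is irrelevant.
  have h : ∀ τ ∈ A, ∃ k : Fin (A.length + 1), A.getD k (.inl 0) = τ := fun τ hτ => by
    obtain ⟨k, hk, rfl⟩ := List.mem_iff_getElem.1 hτ
    exact ⟨⟨k, by lia⟩, List.getD_eq_getElem _ _ hk⟩
  choose! i hi using h
  exact ⟨_, i, fun k => Sum.elim v id (A.getD k (.inl 0)), fun τ hτ => congrArg (Sum.elim v id) (hi τ hτ)⟩

end Definable₂

/-! ### The two schemata for definable predicates. -/

namespace COTStructure.IsModelOfCOT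

variable {M : COTStructure O C} (hM : M.IsModelOfCOT)
include hM

theorem nonempty_ord : Nonempty O := ⟨hM.infinity.choose⟩

theorem nonempty_cls : Nonempty C :=
  ⟨(hM.comprehension (n := 0) (m := 0) .falsum Fin.elim0 Fin.elim0).choose⟩

/-- Comprehension for definable predicates. -/
theorem exists_class (P : O → Prop) [hP : Definable₂ M (fun v _ => P (v 0))] :
    ∃ X, ∀ x, M.mem x X ↔ P x := by
  obtain ⟨a⟩ := hM.nonempty_ord
  obtain ⟨X₀⟩ := hM.nonempty_cls
  obtain ⟨A, B, h⟩ := hP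
  obtain ⟨n, i, x, hx⟩ := Definable₂.exists_numbering (A.map Definable₂.pred) fun _ => a
  obtain ⟨m, j, X, hX⟩ := Definable₂.exists_numbering B fun _ => X₀
  obtain ⟨φ, hφ⟩ := h (n + 1) m (Definable₂.push i) j
  obtain ⟨Y, hY⟩ := hM.comprehension φ x X
  exact ⟨Y, fun y => (hY y).trans (hφ _ _ _ _ (Definable₂.snoc_push hx y) hX)⟩

/-- Well-foundedness of `≺` for definable predicates. -/
theorem exists_minimal (P : C → Prop) [hP : Definable₂ M (fun _ w => P (w 0))]
    (h : ∃ X, P X) : ∃ N, P N ∧ ∀ Y, P Y → ¬ M.prec Y N := by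
  obtain ⟨a⟩ := hM.nonempty_ord
  obtain ⟨X₀⟩ := hM.nonempty_cls
  obtain ⟨A, B, h'⟩ := hP
  obtain ⟨n, i, x, hx⟩ := Definable₂.exists_numbering A fun _ => a
  obtain ⟨m, j, X, hX⟩ := Definable₂.exists_numbering (B.map Definable₂.pred) fun _ => X₀
  obtain ⟨φ, hφ⟩ := h' n (m + 1) i (Definable₂.push j)
  have key : ∀ Y, φ.Realize M x (Fin.snoc X Y : Fin (m + 1) → C) ↔ P Y :=
    fun Y => hφ _ _ _ _ hx (Definable₂.snoc_push hX Y)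
  obtain ⟨Y, hY⟩ := h
  simpa only [key] using hM.wellFounded φ x X Y ((key Y).2 hY)

end COTStructure.IsModelOfCOT

end Definability

/-! ### The order on the ordinals of a model of COT -/

section Order

variable {O : Type u} {C : Type v} {M : COTStructure O C}

namespace COTStructure.IsModelOfCOT

variable (hM : M.IsModelOfCOT)
include hM

theorem prec_irrefl (X : C) : ¬ M.prec X X :=
  fun h => (hM.coConnected X X).2 (.inl h) fun _ => Iff.rfl

theorem prec_trichotomy (X Y : C) : M.CoExt X Y ∨ M.prec X Y ∨ M.prec Y X := by
  have := hM.coConnected X Y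
  tauto

/-- Coextensive classes may be distinct, so the invariance of `≺` has to be derived: either other
case of the trichotomy would make two coextensive classes comparable. -/
theorem prec_of_coExt_of_prec {X X' Y : C} (h : M.CoExt X X') (hY : M.prec X Y) : M.prec X' Y := by
  rcases hM.prec_trichotomy X' Y with h' | h' | h'
  · exact ((hM.coConnected X Y).2 (.inl hY) fun z => (h z).trans (h' z)).elim
  · exact h'
  · exact ((hM.coConnected X X').2 (.inl (hM.transitive _ _ _ hY h')) h).elim

theorem prec_of_prec_of_coExt {X Y Y' : C} (h : M.CoExt Y Y') (hX : M.prec X Y) : M.prec X Y' := by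
  rcases hM.prec_trichotomy X Y' with h' | h' | h'
  · exact ((hM.coConnected X Y).2 (.inl hX) fun z => (h' z).trans (h z).symm).elim
  · exact h'
  · exact ((hM.coConnected Y Y').2 (.inr (hM.transitive _ _ _ h' hX)) h).elim

theorem exists_isSingleton (x : O) : ∃ X, M.IsSingleton X x :=
  hM.exists_class fun y => y = x

theorem lt_iff {X Y : C} {x y : O} (hX : M.IsSingleton X x) (hY : M.IsSingleton Y y) :
    M.Lt x y ↔ M.prec X Y :=
  ⟨fun h => h X Y hX hY, fun h _ _ hX' hY' =>
    hM.prec_of_coExt_of_prec (fun z => (hX z).trans (hX' z).symm)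
      (hM.prec_of_prec_of_coExt (fun z => (hY z).trans (hY' z).symm) h)⟩

theorem lt_irrefl (x : O) : ¬ M.Lt x x := by
  obtain ⟨X, hX⟩ := hM.exists_isSingleton x
  rw [hM.lt_iff hX hX]
  exact hM.prec_irrefl X

theorem lt_trans {x y z : O} (h : M.Lt x y) (h' : M.Lt y z) : M.Lt x z := by
  obtain ⟨X, hX⟩ := hM.exists_isSingleton x
  obtain ⟨Y, hY⟩ := hM.exists_isSingleton y
  obtain ⟨Z, hZ⟩ := hM.exists_isSingleton z
  rw [hM.lt_iff hX hZ]
  exact hM.transitive _ _ _ (h X Y hX hY) (h' Y Z hY hZ)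

theorem lt_trichotomy (x y : O) : M.Lt x y ∨ x = y ∨ M.Lt y x := by
  obtain ⟨X, hX⟩ := hM.exists_isSingleton x
  obtain ⟨Y, hY⟩ := hM.exists_isSingleton y
  rw [hM.lt_iff hX hY, hM.lt_iff hY hX]
  rcases hM.prec_trichotomy X Y with h | h | h
  · exact .inr (.inl ((hY x).1 ((h x).1 ((hX x).2 rfl))))
  · exact .inl h
  · exact .inr (.inr h)

open Classical in
/-- The linear order on the ordinals of a model of COT. -/
noncomputable abbrev linearOrder : LinearOrder O where
  le := M.Le
  lt := M.Lt
  le_refl x := .inr rfl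
  le_trans x y z := by
    rintro (h | rfl) (h' | rfl)
    exacts [.inl (hM.lt_trans h h'), .inl h, .inl h', .inr rfl]
  lt_iff_le_not_ge x y := by
    refine ⟨fun h => ⟨.inl h, ?_⟩, ?_⟩
    · rintro (h' | rfl)
      exacts [hM.lt_irrefl _ (hM.lt_trans h h'), hM.lt_irrefl _ h]
    · rintro ⟨h | rfl, h'⟩
      exacts [h, (h' (.inr rfl)).elim]
  le_antisymm x y := by
    rintro (h | rfl) (h' | h')
    exacts [(hM.lt_irrefl _ (hM.lt_trans h h')).elim, h'.symm, rfl, rfl]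
  le_total x y := by
    rcases hM.lt_trichotomy x y with h | h | h
    exacts [.inl (.inl h), .inl (.inr h), .inr (.inl h)]
  toDecidableLE := Classical.decRel _

end COTStructure.IsModelOfCOT

/-- `M` is a model of COT whose ordinals carry their order as an instance. -/
class OrderedCOTModel [LinearOrder O] (M : COTStructure O C) : Prop where
  isModel : M.IsModelOfCOT
  lt_iff : ∀ x y : O, M.Lt x y ↔ x < y

end Order

namespace OrderedCOTModel

variable {O : Type u} {C : Type v} {M : COTStructure O C} [LinearOrder O] [hM : OrderedCOTModel M]

instance definable_lt (s t : (ℕ → O) → O) [IsTerm s] [IsTerm t] :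
    Definable₂ M (fun v _ => s v < t v) :=
  Definable₂.congr (P := fun v _ => M.Lt (s v) (t v)) inferInstance fun _ _ => lt_iff _ _

instance definable_le (s t : (ℕ → O) → O) [IsTerm s] [IsTerm t] :
    Definable₂ M (fun v _ => s v ≤ t v) :=
  Definable₂.congr (P := fun v _ => ¬ t v < s v) inferInstance fun _ _ => not_lt

variable (M)
include hM

theorem le_iff (x y : O) : M.Le x y ↔ x ≤ y := by
  rw [COTStructure.Le, lt_iff, le_iff_lt_or_eq]

theorem exists_least (P : O → Prop) [Definable₂ M (fun v _ => P (v 0))] (h : ∃ x, P x) :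
    ∃ x, P x ∧ ∀ y, P y → x ≤ y := by
  obtain ⟨X, hX⟩ := hM.isModel.exists_class P
  obtain ⟨x, hx⟩ := h
  -- The order of ordinals is `≺` on singletons, so a `≺`-minimal singleton gives the least element.
  -- The class `X` replaces `P` by an atomic formula with a parameter, which is definable under any
  -- quantifier.
  obtain ⟨Y, hY⟩ := hM.isModel.exists_isSingleton x
  obtain ⟨N, ⟨y, hy, hN⟩, hmin⟩ := hM.isModel.exists_minimal
    (fun Y => ∃ x, M.mem x X ∧ M.IsSingleton Y x) ⟨Y, x, (hX x).2 hx, hY⟩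
  refine ⟨y, (hX y).1 hy, fun z hz => ?_⟩
  obtain ⟨Z, hZ⟩ := hM.isModel.exists_isSingleton z
  rw [← not_lt, ← lt_iff (M := M), hM.isModel.lt_iff hZ hN]
  exact hmin Z ⟨z, (hX z).2 hz, hZ⟩

/-! ### Limits, bounded classes and the index function. -/

theorem isLim_iff {X : C} {l : O} : M.IsLim X l ↔
    (∀ x, M.mem x X → x < l) ∧ ∀ k, (∀ x, M.mem x X → x < k) → l ≤ k := by
  simp only [COTStructure.IsLim, lt_iff, le_iff]

theorem exists_isLim {X : C} {b : O} (h : ∀ x, M.mem x X → x < b) : ∃ l ≤ b, M.IsLim X l := by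
  obtain ⟨l, hl, hmin⟩ := exists_least M (fun b => ∀ x, M.mem x X → x < b) ⟨b, h⟩
  exact ⟨l, hmin b h, (isLim_iff M).2 ⟨hl, hmin⟩⟩

theorem bnd_iff {X : C} : M.Bnd X ↔ ∃ b, ∀ x, M.mem x X → x < b :=
  ⟨fun ⟨l, hl⟩ => ⟨l, ((isLim_iff M).1 hl).1⟩, fun ⟨_, hb⟩ =>
    let ⟨l, _, hl⟩ := exists_isLim M hb; ⟨l, hl⟩⟩

theorem prec_of_bound {X Y : C} {b y : O} (h : ∀ x, M.mem x X → x < b) (hb : b ≤ y)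
    (hy : M.mem y Y) : M.prec X Y := by
  obtain ⟨l, hl, hX⟩ := exists_isLim M h
  exact hM.isModel.respective X Y l y hX ((le_iff M _ _).2 (hl.trans hb)) hy

theorem exists_index {X : C} {b : O} (h : ∀ x, M.mem x X → x < b) : ∃ i, M.index X = some i :=
  hM.isModel.index_exists X ((bnd_iff M).2 ⟨b, h⟩)

theorem index_lt_index {X Y : C} {i j : O} (hX : M.index X = some i) (hY : M.index Y = some j)
    (h : M.prec X Y) : i < j := by
  obtain ⟨Z, hZ⟩ := hM.isModel.exists_class fun z => ∃ X, M.prec X Y ∧ M.index X = some z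
  exact ((isLim_iff M).1 (hM.isModel.index_eq Y j hY Z hZ)).1 i ((hZ i).2 ⟨X, h, hX⟩)

theorem index_le {X : C} {i b : O} (hX : M.index X = some i)
    (h : ∀ Y j, M.prec Y X → M.index Y = some j → j < b) : i ≤ b := by
  obtain ⟨Z, hZ⟩ := hM.isModel.exists_class fun z => ∃ Y, M.prec Y X ∧ M.index Y = some z
  refine ((isLim_iff M).1 (hM.isModel.index_eq X i hX Z hZ)).2 b fun x hx => ?_
  obtain ⟨Y, hY, hx⟩ := (hZ x).1 hx
  exact h Y x hY hx

theorem coExt_of_index_eq {X Y : C} {i : O} (hX : M.index X = some i) (hY : M.index Y = some i) :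
    M.CoExt X Y := by
  rcases hM.isModel.prec_trichotomy X Y with h | h | h
  · exact h
  · exact (index_lt_index M hX hY h).false.elim
  · exact (index_lt_index M hY hX h).false.elim

theorem index_le_of_coExt {X Y : C} {i j : O} (hX : M.index X = some i) (hY : M.index Y = some j)
    (h : M.CoExt X Y) : i ≤ j :=
  index_le M hX fun _ _ hZ hk => index_lt_index M hk hY (hM.isModel.prec_of_prec_of_coExt h hZ)

theorem index_eq_of_coExt {X Y : C} {i j : O} (hX : M.index X = some i) (hY : M.index Y = some j)
    (h : M.CoExt X Y) : i = j :=
  (index_le_of_coExt M hX hY h).antisymm (index_le_of_coExt M hY hX fun z => (h z).symm)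

/-- If `ι({y | y < z}) = i < z`, then `{y | y < i} ≺ {y | y < z}` by the Respective axiom, so `ι({y
| y < i}) < i` and `i` is a smaller counterexample. -/
theorem le_index_initial {S : C} {z i : O} (hS : ∀ y, M.mem y S ↔ y < z)
    (hi : M.index S = some i) : z ≤ i := by
  by_contra! hlt
  obtain ⟨z, ⟨S, i, hS, hi, hlt⟩, hmin⟩ := exists_least M
    (fun z => ∃ S i, (∀ y, M.mem y S ↔ y < z) ∧ M.index S = some i ∧ i < z) ⟨z, S, i, hS, hi, hlt⟩
  obtain ⟨T, hT⟩ := hM.isModel.exists_class fun y => y < i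
  obtain ⟨j, hj⟩ := exists_index M (fun y => (hT y).1)
  refine (hmin i ⟨T, j, hT, hj, ?_⟩).not_gt hlt
  exact index_lt_index M hj hi (prec_of_bound M (fun y => (hT y).1) le_rfl ((hS i).2 hlt))

/-- The initial segment below `y` precedes `X` by the Respective axiom, and its index is already at
least `y`. -/
theorem lt_index_of_mem {X : C} {i y : O} (hX : M.index X = some i) (hy : M.mem y X) : y < i := by
  obtain ⟨S, hS⟩ := hM.isModel.exists_class fun x => x < y
  obtain ⟨j, hj⟩ := exists_index M (fun x => (hS x).1)
  exact (le_index_initial M hS hj).trans_lt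
    (index_lt_index M hj hX (prec_of_bound M (fun x => (hS x).1) le_rfl hy))

/-- If `m` were greatest, the segment `S` below `m` would have index `m`. Deleting the least ordinal
`o` from `S` gives a class `T` with a different index `j < m`. Infinity provides some `y` in `T`, so
`o < y < j`; hence `j` belongs to `T`, whose index is `j`, which is absurd. -/
theorem exists_ord_gt (m : O) : ∃ x, m < x := by
  by_contra! hmax
  obtain ⟨l, ⟨k, hk⟩, hl⟩ := hM.isModel.infinity
  simp only [lt_iff] at hk hl
  obtain ⟨o, -, ho⟩ := exists_least M (fun x => x = x) ⟨l, rfl⟩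
  obtain ⟨y, hoy, hyl⟩ := hl o ((ho k rfl).trans_lt hk)
  obtain ⟨S, hS⟩ := hM.isModel.exists_class fun x => x < m
  obtain ⟨T, hT⟩ := hM.isModel.exists_class fun x => x < m ∧ x ≠ o
  obtain ⟨i, hi⟩ := exists_index M (fun x => (hS x).1)
  obtain ⟨j, hj⟩ := exists_index M (fun x hx => ((hT x).1 hx).1)
  have hym : y < m := hyl.trans_le (hmax l)
  have hyj : y < j := lt_index_of_mem M hj ((hT y).2 ⟨hym, hoy.ne'⟩)
  have him : i = m := (hmax i).antisymm (le_index_initial M hS hi)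
  have hjm : j < m := by
    refine (hmax j).lt_of_ne fun h => ?_
    have := (coExt_of_index_eq M hi (hj.trans (by rw [h, him])) o).1 ((hS o).2 (hoy.trans hym))
    exact ((hT o).1 this).2 rfl
  exact (lt_index_of_mem M hj ((hT j).2 ⟨hjm, (hoy.trans hyj).ne'⟩)).false

/-- The singleton of `x` has an index above `x`. In a `≺`-minimal class with such an index, all
earlier indices are at most `x`; if `x` is not among them they are below `x`, so the limit cannot
exceed `x`. -/
theorem exists_index_eq (x : O) : ∃ X, M.index X = some x := by
  by_contra! hx
  obtain ⟨b, hb⟩ := exists_ord_gt M x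
  obtain ⟨S, hS⟩ := hM.isModel.exists_isSingleton x
  obtain ⟨i, hi⟩ := exists_index M (X := S) (b := b) fun y hy => by rwa [(hS y).1 hy]
  obtain ⟨N, ⟨j, hj, hxj⟩, hmin⟩ := hM.isModel.exists_minimal
    (fun X => ∃ i, M.index X = some i ∧ x < i) ⟨S, i, hi, lt_index_of_mem M hi ((hS x).2 rfl)⟩
  refine (index_le M hj fun Y k hY hk => ?_).not_gt hxj
  refine lt_of_le_of_ne (not_lt.1 fun h => hmin Y ⟨k, hk, h⟩ hY) ?_
  rintro rfl
  exact hx Y hk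

/-! ### Sets -/

theorem setMem_iff {X : C} {x : O} (hX : M.index X = some x) (y : O) :
    M.SetMem y x ↔ M.mem y X :=
  ⟨fun ⟨_, hy, hY⟩ => (coExt_of_index_eq M hX hY y).2 hy, fun h => ⟨X, h, hX⟩⟩

variable {M} in
theorem lt_of_setMem {x y : O} (h : M.SetMem y x) : y < x :=
  let ⟨_, hy, hX⟩ := h
  lt_index_of_mem M hX hy

theorem set_ext {x y : O} (h : ∀ z, M.SetMem z x ↔ M.SetMem z y) : x = y := by
  obtain ⟨X, hX⟩ := exists_index_eq M x
  obtain ⟨Y, hY⟩ := exists_index_eq M y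
  refine index_eq_of_coExt M hX hY fun z => ?_
  rw [← setMem_iff M hX, h, setMem_iff M hY]

theorem exists_set (P : O → Prop) [Definable₂ M (fun v _ => P (v 0))] {b : O}
    (h : ∀ x, P x → x < b) : ∃ a, ∀ x, M.SetMem x a ↔ P x := by
  obtain ⟨X, hX⟩ := hM.isModel.exists_class P
  obtain ⟨a, ha⟩ := exists_index M fun x hx => h x ((hX x).1 hx)
  exact ⟨a, fun x => (setMem_iff M ha x).trans (hX x)⟩

/-- A set whose elements are all smaller than some element of `y` is smaller than `y`. -/
theorem lt_of_bound {x y b z : O} (hx : ∀ w, M.SetMem w x → w < b) (hb : b ≤ z)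
    (hz : M.SetMem z y) : x < y := by
  obtain ⟨X, hX⟩ := exists_index_eq M x
  obtain ⟨Y, hY⟩ := exists_index_eq M y
  exact index_lt_index M hX hY (prec_of_bound M (fun w hw => hx w ((setMem_iff M hX w).2 hw)) hb
    ((setMem_iff M hY z).1 hz))

theorem exists_isSingletonSet (z : O) : ∃ c, ∀ x, M.SetMem x c ↔ x = z := by
  obtain ⟨b, hb⟩ := exists_ord_gt M z
  exact exists_set M (fun x => x = z) (b := b) (by rintro _ rfl; exact hb)

end OrderedCOTModel

namespace OrderedCOTModel

variable {O : Type u} {C : Type v} (M : COTStructure O C) [LinearOrder O] [hM : OrderedCOTModel M]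
include hM

/-! ### Pairs and replacement -/

theorem exists_isPair (a b : O) : ∃ p, M.IsPair p a b := by
  have key : ∀ a b : O, ∃ A i, M.IsDoubleton A a b ∧ M.index A = some i := by
    intro a b
    obtain ⟨c, hc⟩ := exists_ord_gt M (max a b)
    obtain ⟨A, hA⟩ := hM.isModel.exists_class fun x => x = a ∨ x = b
    obtain ⟨i, hi⟩ := exists_index M (X := A) (b := c) fun x hx => by
      rcases (hA x).1 hx with rfl | rfl
      exacts [(le_max_left _ _).trans_lt hc, (le_max_right _ _).trans_lt hc]
    exact ⟨A, i, hA, hi⟩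
  obtain ⟨A, s, hA, hs⟩ := key a a
  obtain ⟨B, t, hB, ht⟩ := key a b
  obtain ⟨P, p, hP, hp⟩ := key s t
  exact ⟨p, A, B, P, s, t, fun z => by simpa using hA z, hB, hs, ht, hP, hp⟩

-- Kuratowski's argument, available because `ι` is injective up to coextension.
variable {M} in
theorem isPair_injective {p a b c d : O} (h : M.IsPair p a b) (h' : M.IsPair p c d) :
    a = c ∧ b = d := by
  obtain ⟨A, B, P, s, t, hA, hB, hs, ht, hP, hp⟩ := h
  obtain ⟨A', B', P', s', t', hA', hB', hs', ht', hP', hp'⟩ := h'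
  have hPP := coExt_of_index_eq M hp hp'
  have h₁ : ∀ z, z = s ∨ z = t ↔ z = s' ∨ z = t' := fun z =>
    (hP z).symm.trans ((hPP z).trans (hP' z))
  have hs₁ : ∀ z, M.SetMem z s ↔ z = a := fun z => (setMem_iff M hs z).trans (hA z)
  have ht₁ : ∀ z, M.SetMem z t ↔ z = a ∨ z = b := fun z => (setMem_iff M ht z).trans (hB z)
  have hs₂ : ∀ z, M.SetMem z s' ↔ z = c := fun z => (setMem_iff M hs' z).trans (hA' z)
  have ht₂ : ∀ z, M.SetMem z t' ↔ z = c ∨ z = d := fun z => (setMem_iff M ht' z).trans (hB' z)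
  clear hPP hP hp hP' hp' hA hB hA' hB' hs ht hs' ht'
  grind [h₁ s, h₁ t, h₁ s', h₁ t', hs₁ a, ht₁ a, ht₁ b, hs₂ c, ht₂ c, ht₂ d]

/-- The image of a set under a definable function is bounded. -/
theorem exists_bound_image (R : O → O → Prop)
    [hR : ∀ (s t : (ℕ → O) → O) [IsTerm s] [IsTerm t], Definable₂ M (fun v _ => R (s v) (t v))]
    (a : O) (hfun : ∀ x y z, M.SetMem x a → R x y → R x z → y = z) :
    ∃ b, ∀ x y, M.SetMem x a → R x y → y < b := by
  -- The relation need not be injective, so only the least argument for each value is kept. Then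
  -- `X'` is the domain, `Y` the full image and `F` the graph of a bijection between them.
  obtain ⟨X, hX⟩ := hM.isModel.exists_class fun x =>
    M.SetMem x a ∧ ∀ x', x' < x → M.SetMem x' a → ∀ y, R x y → ¬ R x' y
  obtain ⟨X', hX'⟩ := hM.isModel.exists_class fun x => M.mem x X ∧ ∃ y, R x y
  obtain ⟨Y, hY⟩ := hM.isModel.exists_class fun y => ∃ x, M.SetMem x a ∧ R x y
  obtain ⟨F, hF⟩ := hM.isModel.exists_class fun p => ∃ x y, M.mem x X ∧ R x y ∧ M.IsPair p x y
  have hpair : ∀ x y, M.PairMem F x y ↔ M.mem x X ∧ R x y := by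
    refine fun x y => ⟨?_, fun h => ?_⟩
    · rintro ⟨p, hp, hxy⟩
      obtain ⟨x', y', hx', hR', hp'⟩ := (hF p).1 hp
      obtain ⟨rfl, rfl⟩ := isPair_injective hxy hp'
      exact ⟨hx', hR'⟩
    · obtain ⟨p, hp⟩ := exists_isPair M x y
      exact ⟨p, (hF p).2 ⟨x, y, h.1, h.2, hp⟩, hp⟩
  have hbij : M.IsBijection F X' Y := by
    refine ⟨fun p hp => ?_, fun x hx => ?_, fun y hy => ?_⟩
    · obtain ⟨x, y, hx, hxy, hp⟩ := (hF p).1 hp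
      exact ⟨x, y, (hX' x).2 ⟨hx, y, hxy⟩, (hY y).2 ⟨x, ((hX x).1 hx).1, hxy⟩, hp⟩
    · obtain ⟨hxX, y, hxy⟩ := (hX' x).1 hx
      have hxa := ((hX x).1 hxX).1
      exact ⟨y, ⟨(hY y).2 ⟨x, hxa, hxy⟩, (hpair x y).2 ⟨hxX, hxy⟩⟩, fun z hz =>
        hfun x z y hxa ((hpair x z).1 hz.2).2 hxy⟩
    · obtain ⟨x, ⟨hxa, hxy⟩, hmin⟩ :=
        exists_least M (fun x => M.SetMem x a ∧ R x y) ((hY y).1 hy)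
      have hxX : M.mem x X := (hX x).2 ⟨hxa, fun x' hx' hx'a z hxz hx'z =>
        (hmin x' ⟨hx'a, hfun x y z hxa hxy hxz ▸ hx'z⟩).not_gt hx'⟩
      refine ⟨x, ⟨(hX' x).2 ⟨hxX, y, hxy⟩, (hpair x y).2 ⟨hxX, hxy⟩⟩, fun x' hx' => ?_⟩
      obtain ⟨hx'X, hx'y⟩ := (hpair x' y).1 hx'.2
      have hx' := (hX x').1 hx'X
      exact (not_lt.1 fun h => hx'.2 x h hxa y hx'y hxy).antisymm (hmin x' ⟨hx'.1, hx'y⟩)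
  have hbnd := hM.isModel.boundedness X' Y ((bnd_iff M).2
    ⟨a, fun x hx => lt_of_setMem ((hX x).1 ((hX' x).1 hx).1).1⟩) ⟨F, hbij⟩
  obtain ⟨b, hb⟩ := (bnd_iff M).1 hbnd
  exact ⟨b, fun x y hx hxy => hb y ((hY y).2 ⟨x, hx, hxy⟩)⟩

/-! ### Infinity -/

theorem exists_omega : ∃ ω : O, (∃ k, k < ω) ∧ (∀ x < ω, ∃ n < ω, ∀ y, y < n ↔ y ≤ x) ∧
    ∀ n < ω, (∀ k, ¬ k < n) ∨ ∃ x, ∀ y, y < n ↔ y ≤ x := by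
  obtain ⟨l, hl⟩ := hM.isModel.infinity
  simp only [lt_iff] at hl
  obtain ⟨ω, ⟨hpos, hlim⟩, hmin⟩ := exists_least M
    (fun l => (∃ k, k < l) ∧ ∀ x, x < l → ∃ y, x < y ∧ y < l) ⟨l, hl⟩
  refine ⟨ω, hpos, fun x hx => ?_, fun n hn => or_iff_not_imp_left.2 fun hk => ?_⟩
  · obtain ⟨y, hxy, hy⟩ := hlim x hx
    obtain ⟨n, hn, hnmin⟩ := exists_least M (fun y => x < y) ⟨y, hxy⟩
    exact ⟨n, (hnmin y hxy).trans_lt hy, fun z =>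
      ⟨fun hz => not_lt.1 fun h => (hnmin z h).not_gt hz, fun hz => hz.trans_lt hn⟩⟩
  · push Not at hk
    by_contra! h
    -- A nonzero `n < ω` without a predecessor would be a smaller limit.
    refine (hmin n ⟨hk, fun x hx => ?_⟩).not_gt hn
    by_contra! h'
    obtain ⟨y, hy⟩ := h x
    rcases hy with ⟨h₁, h₂⟩ | ⟨h₁, h₂⟩
    · exact (h' y h₂).not_gt h₁
    · exact (h₂.trans_lt hx).not_ge h₁

/-- There are only finitely many sets of ordinals below a finite ordinal. -/
theorem exists_bound_powerset {ω : O} (hpos : ∃ k, k < ω)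
    (hsucc : ∀ x < ω, ∃ n < ω, ∀ y, y < n ↔ y ≤ x)
    (hind : ∀ n < ω, (∀ k, ¬ k < n) ∨ ∃ x, ∀ y, y < n ↔ y ≤ x) {n : O} (hn : n < ω) :
    ∃ k < ω, ∀ x, (∀ y, M.SetMem y x → y < n) → x < k := by
  by_contra hcon
  obtain ⟨n, ⟨hn, hcon⟩, hmin⟩ := exists_least M (fun n => n < ω ∧
    ¬ ∃ k, k < ω ∧ ∀ x, (∀ y, M.SetMem y x → y < n) → x < k) ⟨n, hn, hcon⟩
  refine hcon ?_
  rcases hind n hn with hzero | ⟨p, hp⟩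
  · obtain ⟨o, ho⟩ := hpos
    obtain ⟨o, -, hmin⟩ := exists_least M (fun x => x = x) ⟨o, rfl⟩
    obtain ⟨k, hk, hok⟩ := hsucc o ((hmin _ rfl).trans_lt ho)
    -- The only such set is the empty one, and that is the least ordinal `o`, since elements of a
    -- set lie below it.
    refine ⟨k, hk, fun x hx => (hok x).2 (le_of_eq (set_ext M fun z => ⟨fun h => ?_, fun h => ?_⟩))⟩
    · exact (hzero _ (hx z h)).elim
    · exact ((hmin z rfl).not_gt (lt_of_setMem h)).elim
  have hpn : p < n := (hp p).2 le_rfl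
  obtain ⟨k, hk, hkp⟩ : ∃ k < ω, ∀ x, (∀ y, M.SetMem y x → y < p) → x < k := by
    by_contra h
    exact (hmin p ⟨hpn.trans hn, h⟩).not_gt hpn
  -- Adjoining `p` to the sets `z < k` yields values bounded below `ω`, by a second induction, on
  -- `k`. The proviso `x < ω` is essential here: that adjunction does not lead beyond `ω` is not yet
  -- known.
  obtain ⟨k', hk', hadj⟩ : ∃ k' < ω, ∀ z < k, ∀ x,
      (∀ y, M.SetMem y x ↔ M.SetMem y z ∨ y = p) → x < ω → x < k' := by
    by_contra hcon'
    obtain ⟨j, ⟨hj, hcon'⟩, hjmin⟩ := exists_least M (fun k => k < ω ∧ ¬ ∃ k', k' < ω ∧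
      ∀ z, z < k → ∀ x, (∀ y, M.SetMem y x ↔ M.SetMem y z ∨ y = p) → x < ω → x < k') ⟨k, hk, hcon'⟩
    refine hcon' ?_
    rcases hind j hj with hzero | ⟨q, hq⟩
    · exact ⟨k, hk, fun z hz => (hzero z hz).elim⟩
    have hqj : q < j := (hq q).2 le_rfl
    obtain ⟨k', hk', h'⟩ : ∃ k', k' < ω ∧ ∀ z, z < q → ∀ x,
        (∀ y, M.SetMem y x ↔ M.SetMem y z ∨ y = p) → x < ω → x < k' := by
      by_contra h
      exact (hjmin q ⟨hqj.trans hj, h⟩).not_gt hqj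
    by_cases hex : ∃ x, (∀ y, M.SetMem y x ↔ M.SetMem y q ∨ y = p) ∧ x < ω
    · obtain ⟨x, hx, hxω⟩ := hex
      obtain ⟨m, hm, hxm⟩ := hsucc x hxω
      refine ⟨max k' m, max_lt hk' hm, fun z hz x' hx' hx'ω => ?_⟩
      rcases ((hq z).1 hz).lt_or_eq with hz | rfl
      · exact (h' z hz x' hx' hx'ω).trans_le (le_max_left _ _)
      · rw [set_ext M fun y => (hx' y).trans (hx y).symm]
        exact ((hxm x).2 le_rfl).trans_le (le_max_right _ _)
    · refine ⟨k', hk', fun z hz x hx hxω => ?_⟩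
      rcases ((hq z).1 hz).lt_or_eq with hz | rfl
      · exact h' z hz x hx hxω
      · exact (hex ⟨x, hx, hxω⟩).elim
  -- A set of ordinals below `n = p + 1` either omits `p` or arises by adjoining `p` to a set of
  -- ordinals below `p`.
  have hlt : ∀ x, (∀ y, M.SetMem y x → y < n) → x < ω → x < max k k' := by
    intro x hx hxω
    by_cases hpx : M.SetMem p x
    · obtain ⟨z, hz⟩ := exists_set M (fun y => M.SetMem y x ∧ y ≠ p) fun y hy => hx y hy.1
      refine (hadj z (hkp z fun y hy => ?_) x (fun y => ?_) hxω).trans_le (le_max_right _ _)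
      · exact ((hp y).1 (hx y ((hz y).1 hy).1)).lt_of_ne ((hz y).1 hy).2
      · rw [hz]
        by_cases h : y = p <;> simp [h, hpx]
    · refine (hkp x fun y hy => ((hp y).1 (hx y hy)).lt_of_ne ?_).trans_le (le_max_left _ _)
      rintro rfl
      exact hpx hy
  -- To remove the proviso, suppose `ω ≤ x` and regard `max k k'`, which is below `ω`, as a set
  -- itself. An element of it not below `n` would give `x < max k k'`; so its elements are below
  -- `n`, and `hlt` puts it below itself.
  refine ⟨max k k', max_lt hk hk', fun x hx => hlt x hx ?_⟩
  by_contra! hωx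
  refine (hlt (max k k') (fun y hy => ?_) (max_lt hk hk')).false
  by_contra! hny
  exact (lt_of_bound M hx hny hy).not_gt ((max_lt hk hk').trans_le hωx)

end OrderedCOTModel

/-! ### The axioms of ZFC -/

namespace ZFC

open FirstOrder.Language

variable {O : Type u} {C : Type v} (M : COTStructure O C)

theorem realize_mem {n : ℕ} (i j : Fin n) (e : Empty → O) (x : Fin n → O) :
    @BoundedFormula.Realize setLang O M.setStructure _ _ (mem i j) e x ↔ M.SetMem (x i) (x j) :=
  Iff.rfl

theorem realize_eq {n : ℕ} (i j : Fin n) (e : Empty → O) (x : Fin n → O) :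
    @BoundedFormula.Realize setLang O M.setStructure _ _ (eq i j) e x ↔ x i = x j :=
  Iff.rfl

theorem realize_inst {n k r : ℕ} (φ : setLang.Formula (Fin n ⊕ Fin k)) {t : Fin k → Fin (n + r)}
    {e : Empty → O} {x : Fin (n + r) → O} {p : Fin n → O} {y : Fin k → O}
    (hp : ∀ i, x (Fin.castAdd r i) = p i) (hy : ∀ j, x (t j) = y j) :
    @BoundedFormula.Realize setLang O M.setStructure _ _ (inst r φ t) e x ↔
      @Formula.Realize setLang O M.setStructure _ φ (Sum.elim p y) := by
  let _ := M.setStructure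
  rw [inst, BoundedFormula.realize_relabel, Formula.Realize]
  refine iff_of_eq (congrArg₂ _ ?_ (Subsingleton.elim _ _))
  funext i
  rcases i with i | j
  exacts [hp i, hy j]

/-- Formulas of set theory define definable relations. -/
theorem definable_realize {α : Type*} (φ : setLang.Formula α) (s : α → (ℕ → O) → O)
    (hs : ∀ i, IsTerm (s i)) :
    Definable₂ M (fun v _ => @Formula.Realize setLang O M.setStructure _ φ fun i => s i v) :=
  (Definable₂.realize φ s Fin.elim0 hs fun i => i.elim0).congr fun _ _ =>
    iff_of_eq (congrArg _ (Subsingleton.elim _ _))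

/-- The schema parameters are the first `n` entries of `p`, and the set `a` is its last entry; this
locates them after further variables are appended. -/
theorem snoc_snoc {α : Type*} {n : ℕ} (p : Fin (n + 1) → α) (x y : α) :
    let q : Fin (n + 3) → α := Fin.snoc (Fin.snoc p x : Fin (n + 2) → α) y
    (∀ i, q (Fin.castAdd 3 i) = p i.castSucc) ∧ q (Fin.natAdd n 0) = p (Fin.last n) ∧
      q (Fin.natAdd n 1) = x ∧ q (Fin.natAdd n 2) = y := by
  simp only [Fin.snoc, Fin.val_castAdd, Fin.val_natAdd]
  refine ⟨fun i => ?_, ?_⟩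
  · rw [dif_pos (by lia), dif_pos (by simp)]
    rfl
  · simp
    rfl

theorem snoc_snoc_snoc {α : Type*} {n : ℕ} (p : Fin (n + 1) → α) (x y z : α) :
    let q : Fin (n + 4) → α :=
      Fin.snoc (Fin.snoc (Fin.snoc p x : Fin (n + 2) → α) y : Fin (n + 3) → α) z
    (∀ i, q (Fin.castAdd 4 i) = p i.castSucc) ∧ q (Fin.natAdd n 0) = p (Fin.last n) ∧
      q (Fin.natAdd n 1) = x ∧ q (Fin.natAdd n 2) = y ∧ q (Fin.natAdd n 3) = z := by
  simp only [Fin.snoc, Fin.val_castAdd, Fin.val_natAdd]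
  refine ⟨fun i => ?_, ?_⟩
  · rw [dif_pos (by lia), dif_pos (by simp; lia), dif_pos (by simp)]
    rfl
  · simp
    rfl

variable [LinearOrder O] [hM : OrderedCOTModel M]

open OrderedCOTModel

include hM

theorem realize_extensionality : @Sentence.Realize setLang O M.setStructure extensionality := by
  let _ := M.setStructure
  simp only [Sentence.Realize, Formula.Realize, extensionality, BoundedFormula.realize_all,
    BoundedFormula.realize_imp, BoundedFormula.realize_iff, realize_mem, realize_eq]
  exact fun x y h => set_ext M h

theorem realize_regularity : @Sentence.Realize setLang O M.setStructure regularity := by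
  let _ := M.setStructure
  simp only [Sentence.Realize, Formula.Realize, regularity, BoundedFormula.realize_all,
    BoundedFormula.realize_imp, BoundedFormula.realize_ex, BoundedFormula.realize_inf,
    BoundedFormula.realize_not, realize_mem]
  intro a h
  obtain ⟨y, hy, hmin⟩ := exists_least M (fun y => M.SetMem y a) h
  exact ⟨y, hy, fun ⟨z, hzy, hza⟩ => (hmin z hza).not_gt (lt_of_setMem hzy)⟩

theorem realize_pairing : @Sentence.Realize setLang O M.setStructure pairing := by
  let _ := M.setStructure
  simp only [Sentence.Realize, Formula.Realize, pairing, BoundedFormula.realize_all,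
    BoundedFormula.realize_iff, BoundedFormula.realize_ex, BoundedFormula.realize_sup,
    realize_mem, realize_eq]
  intro a b
  obtain ⟨c, hc⟩ := exists_ord_gt M (max a b)
  obtain ⟨x, hx⟩ := exists_set M (fun y => y = a ∨ y = b) (b := c) (by
    rintro _ (rfl | rfl)
    exacts [(le_max_left _ _).trans_lt hc, (le_max_right _ _).trans_lt hc])
  exact ⟨x, hx⟩

theorem realize_union : @Sentence.Realize setLang O M.setStructure union := by
  let _ := M.setStructure
  simp only [Sentence.Realize, Formula.Realize, union, BoundedFormula.realize_all,
    BoundedFormula.realize_iff, BoundedFormula.realize_ex, BoundedFormula.realize_inf,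
    realize_mem]
  intro a
  obtain ⟨x, hx⟩ := exists_set M (fun y => ∃ z, M.SetMem z a ∧ M.SetMem y z) (b := a)
    fun y ⟨z, hz, hy⟩ => (lt_of_setMem hy).trans (lt_of_setMem hz)
  exact ⟨x, hx⟩

theorem realize_power : @Sentence.Realize setLang O M.setStructure power := by
  let _ := M.setStructure
  simp only [Sentence.Realize, Formula.Realize, power, BoundedFormula.realize_all,
    BoundedFormula.realize_iff, BoundedFormula.realize_ex, BoundedFormula.realize_imp,
    realize_mem]
  intro a
  obtain ⟨c, hc⟩ := exists_isSingletonSet M a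
  -- Elements of a subset of `a` are below `a`, which is an element of `c = {a}`; so every subset is
  -- below `c`.
  obtain ⟨x, hx⟩ := exists_set M (fun y => ∀ z, M.SetMem z y → M.SetMem z a) (b := c)
    fun y hy => lt_of_bound M (fun w hw => lt_of_setMem (hy w hw)) le_rfl ((hc a).2 rfl)
  exact ⟨x, hx⟩

theorem realize_infinity : @Sentence.Realize setLang O M.setStructure infinity := by
  let _ := M.setStructure
  simp only [Sentence.Realize, Formula.Realize, infinity, BoundedFormula.realize_all,
    BoundedFormula.realize_iff, BoundedFormula.realize_ex, BoundedFormula.realize_imp,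
    BoundedFormula.realize_inf, BoundedFormula.realize_sup, BoundedFormula.realize_not,
    realize_mem, realize_eq]
  obtain ⟨ω, hpos, hsucc, hind⟩ := exists_omega M
  obtain ⟨a, ha⟩ := exists_set M (fun x => x < ω) (b := ω) fun _ => id
  -- Closure under `x ∪ {x}` follows by applying this to the successor `n` of `x`.
  have hsub : ∀ n < ω, ∀ x, (∀ y, M.SetMem y x → y < n) → M.SetMem x a := by
    intro n hn x hx
    obtain ⟨k, hk, h⟩ := exists_bound_powerset M hpos hsucc hind hn
    exact (ha x).2 ((h x hx).trans hk)
  obtain ⟨o, ho⟩ := hpos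
  obtain ⟨e, he⟩ := exists_set M (fun _ => False) (b := o) fun _ h => h.elim
  refine ⟨a, ⟨e, hsub o ho e fun y hy => ((he y).1 hy).elim, fun z => (he z).1⟩, fun x hx => ?_⟩
  obtain ⟨n, hn, hxn⟩ := hsucc x ((ha x).1 hx)
  have hbound : ∀ y, M.SetMem y x ∨ y = x → y < n := by
    rintro y (hy | rfl)
    exacts [(hxn y).2 (lt_of_setMem hy).le, (hxn y).2 le_rfl]
  obtain ⟨s, hs⟩ := exists_set M (fun y => M.SetMem y x ∨ y = x) hbound
  exact ⟨s, hsub n hn s fun y hy => hbound y ((hs y).1 hy), hs⟩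

theorem realize_choice : @Sentence.Realize setLang O M.setStructure choice := by
  let _ := M.setStructure
  simp only [Sentence.Realize, Formula.Realize, choice, BoundedFormula.realize_all,
    BoundedFormula.realize_iff, BoundedFormula.realize_ex, BoundedFormula.realize_imp,
    BoundedFormula.realize_inf, realize_mem, realize_eq]
  suffices h : ∀ a, ((∀ x, M.SetMem x a → ∃ y, M.SetMem y x) ∧
      ∀ x y, ((M.SetMem x a ∧ M.SetMem y a) ∧ ∃ z, M.SetMem z x ∧ M.SetMem z y) → x = y) →
      ∃ c, ∀ x, M.SetMem x a → ∃ y, ∀ z, (M.SetMem z x ∧ M.SetMem z c) ↔ z = y from h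
  rintro a ⟨hne, hdisj⟩
  -- The transversal consists of the least element of each member of `a`.
  obtain ⟨c, hc⟩ := exists_set M
    (fun y => ∃ x, M.SetMem x a ∧ M.SetMem y x ∧ ∀ z, M.SetMem z x → y ≤ z) (b := a)
    fun y ⟨x, hx, hy, _⟩ => (lt_of_setMem hy).trans (lt_of_setMem hx)
  refine ⟨c, fun x hx => ?_⟩
  obtain ⟨y, hy, hmin⟩ := exists_least M (fun y => M.SetMem y x) (hne x hx)
  refine ⟨y, fun z => ⟨fun ⟨hzx, hzc⟩ => ?_, ?_⟩⟩
  · obtain ⟨x', hx', hzx', hmin'⟩ := (hc z).1 hzc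
    obtain rfl := hdisj x x' ⟨⟨hx, hx'⟩, z, hzx, hzx'⟩
    exact (hmin' y hy).antisymm (hmin z hzx)
  · rintro rfl
    exact ⟨hy, (hc z).2 ⟨x, hx, hy, hmin⟩⟩

theorem realize_separation {n : ℕ} (φ : setLang.Formula (Fin n ⊕ Fin 2)) :
    @Sentence.Realize setLang O M.setStructure (separation φ) := by
  let _ := M.setStructure
  refine BoundedFormula.realize_alls.2 fun p => ?_
  simp only [BoundedFormula.realize_all, BoundedFormula.realize_ex, BoundedFormula.realize_iff,
    BoundedFormula.realize_inf, realize_mem]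
  set a := p (Fin.last n)
  have : Definable₂ M fun v _ => φ.Realize (Sum.elim (fun i => p i.castSucc) ![a, v 0]) := by
    refine (definable_realize M φ (Sum.elim (fun i _ => p i.castSucc) ![fun _ => a, fun v => v 0])
      ?_).congr fun v _ => iff_of_eq (congrArg _ ?_)
    · rintro (i | i)
      · exact IsTerm.const _
      · fin_cases i
        exacts [IsTerm.const _, IsTerm.var 0]
    · ext (i | i)
      · rfl
      · fin_cases i <;> rfl
  obtain ⟨x, hx⟩ := exists_set M
    (fun y => M.SetMem y a ∧ φ.Realize (Sum.elim (fun i => p i.castSucc) ![a, y])) (b := a)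
    fun y hy => lt_of_setMem hy.1
  refine ⟨x, fun y => ?_⟩
  obtain ⟨h, h₀, h₁, h₂⟩ := snoc_snoc p x y
  rw [realize_inst M φ (y := ![a, y]) h fun j => by fin_cases j <;> assumption, h₀, h₁, h₂]
  exact hx y

theorem realize_replacement {n : ℕ} (φ : setLang.Formula (Fin n ⊕ Fin 3)) :
    @Sentence.Realize setLang O M.setStructure (replacement φ) := by
  let _ := M.setStructure
  refine BoundedFormula.realize_alls.2 fun p => ?_
  simp only [BoundedFormula.realize_all, BoundedFormula.realize_ex, BoundedFormula.realize_iff,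
    BoundedFormula.realize_imp, BoundedFormula.realize_inf, realize_eq, realize_mem]
  set a := p (Fin.last n)
  -- Making `R` opaque lets its definability come from `hR` alone, at arbitrary terms.
  obtain ⟨R, hRφ⟩ : ∃ R : O → O → Prop, ∀ x y,
      φ.Realize (Sum.elim (fun i => p i.castSucc) ![a, x, y]) ↔ R x y := ⟨_, fun _ _ => Iff.rfl⟩
  have hR : ∀ (s t : (ℕ → O) → O) [IsTerm s] [IsTerm t],
      Definable₂ M fun v _ => R (s v) (t v) := by
    intro s t hs ht
    refine (definable_realize M φ (Sum.elim (fun i _ => p i.castSucc) ![fun _ => a, s, t])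
      ?_).congr fun v _ => (iff_of_eq (congrArg _ ?_)).trans (hRφ (s v) (t v))
    · rintro (i | i)
      · exact IsTerm.const _
      · fin_cases i
        exacts [IsTerm.const _, hs, ht]
    · ext (i | i)
      · rfl
      · fin_cases i <;> rfl
  intro hfun
  replace hfun : ∀ x y z, M.SetMem x a → R x y → R x z → y = z := by
    intro x y z hx hy hz
    obtain ⟨h, h₀, h₁, h₂, h₃⟩ := snoc_snoc_snoc p x y z
    have := hfun x y z
    rw [realize_inst M φ (y := ![a, x, y]) h fun j => by fin_cases j <;> assumption,
      realize_inst M φ (y := ![a, x, z]) h fun j => by fin_cases j <;> assumption,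
      hRφ, hRφ, h₀, h₁, h₂, h₃] at this
    exact this ⟨⟨hx, hy⟩, hz⟩
  obtain ⟨c, hc⟩ := exists_bound_image M R (hR := hR) a hfun
  obtain ⟨b, hb⟩ := exists_set M (fun y => ∃ x, M.SetMem x a ∧ R x y) (b := c)
    fun y ⟨x, hx, hy⟩ => hc x y hx hy
  refine ⟨b, fun y => ?_⟩
  obtain ⟨-, -, h₁, h₂⟩ := snoc_snoc p b y
  rw [h₁, h₂, hb]
  refine exists_congr fun x => ?_
  obtain ⟨h, h₀, h₁, h₂, h₃⟩ := snoc_snoc_snoc p b y x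
  rw [realize_inst M φ (y := ![a, x, y]) h fun j => by fin_cases j <;> assumption, hRφ, h₀, h₃]

theorem realize_axiom {σ : setLang.Sentence} (hσ : Axiom σ) :
    @Sentence.Realize setLang O M.setStructure σ := by
  cases hσ with
  | extensionality => exact realize_extensionality M
  | regularity => exact realize_regularity M
  | pairing => exact realize_pairing M
  | union => exact realize_union M
  | power => exact realize_power M
  | separation φ => exact realize_separation M φ
  | infinity => exact realize_infinity M
  | choice => exact realize_choice M
  | replacement φ => exact realize_replacement M φ

end ZFC

/-! ### The interpretation -/

theorem setTermVar_realize {O : Type u} {C : Type v} (M : COTStructure O C) {n : ℕ}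
    (t : setLang.Term (Empty ⊕ Fin n)) (e : Empty → O) (x : Fin n → O) :
    @Language.Term.realize setLang O M.setStructure _ (Sum.elim e x) t = x (setTermVar t) := by
  rcases t with (i | i) | f
  · exact i.elim
  · rfl
  · exact Empty.elim f

theorem realize_translateSet {O : Type u} {C : Type v} (M : COTStructure O C) {n : ℕ}
    (φ : setLang.BoundedFormula Empty n) (e : Empty → O) (x : Fin n → O) (X : Fin 0 → C) :
    (translateSet φ).Realize M x X ↔
      @Language.BoundedFormula.Realize setLang O M.setStructure _ _ φ e x := by
  induction φ with
  | falsum => rfl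
  | equal s t =>
    simp [translateSet, COTFormula.Realize, Language.BoundedFormula.Realize, setTermVar_realize]
  | rel R ts =>
    cases R
    simp [translateSet, COTFormula.Realize, Language.BoundedFormula.Realize, setTermVar_realize,
      COTFormula.setMem, COTFormula.exCls, COTFormula.neg, COTFormula.and,
      Language.Structure.RelMap, COTStructure.SetMem]
    rfl
  | imp φ ψ hφ hψ => exact imp_congr (hφ x) (hψ x)
  | all φ hφ => exact forall_congr' fun a => hφ _

theorem mainTheorem1 :
    (∀ (O : Type u) (C : Type v) (M : COTStructure O C), M.IsModelOfCOT →
      @FirstOrder.Language.Theory.Model setLang O M.setStructure ZFC.theory) ∧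
    (∀ σ ∈ ZFC.theory, COTEntails.{u, v} (translateSet σ)) := by
  have key : ∀ (O : Type u) (C : Type v) (M : COTStructure O C), M.IsModelOfCOT →
      ∀ σ ∈ ZFC.theory, @Language.Sentence.Realize setLang O M.setStructure σ := by
    intro O C M hM σ hσ
    let _ := hM.linearOrder
    have : OrderedCOTModel M := ⟨hM, fun _ _ => Iff.rfl⟩
    exact ZFC.realize_axiom M hσ
  refine ⟨fun O C M hM => ?_, fun σ hσ O C M hM => ?_⟩
  · let _ := M.setStructure
    exact ⟨fun σ hσ => key O C M hM σ hσ⟩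
  · refine (realize_translateSet M σ default Fin.elim0 Fin.elim0).2 ?_
    have := key O C M hM σ hσ
    simp only [Language.Sentence.Realize, Language.Formula.Realize] at this
    convert this
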